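/- Equip $\mathbb{C}^8$ with the standard symplectic form $\omega_{st}=\frac{i}{2}\sum_{j=1}^8 dz_j\wedge d\bar z_j=\sum_j dx_j\wedge dy_j$ and let $\mathcal{L}:\mathbb{C}^8\to\mathbb{R}^6$ be $$\mathcal{L}(z)=-\tfrac12\bigl(|z_1|^2+|z_5|^2-6,\ |z_2|^2+|z_5|^2+|z_7|^2-10,\ |z_3|^2+|z_7|^2-6,\ |z_4|^2-|z_5|^2+|z_7|^2-4,\ |z_5|^2-|z_6|^2+|z_7|^2-2,\ |z_5|^2-|z_7|^2+|z_8|^2-4\bigr).$$ It generates an action of the torus $\mathbb{T}^6$. Let $M=\mathcal{L}^{-1}(0)/\mathbb{T}^6$ be the symplectic quotient, a smooth 4-dimensional manifold with symplectic form $\omega$ determined by $\tau^*\omega=\kappa^*\omega_{st}$, where $\tau:\mathcal{L}^{-1}(0)\to M$ is the projection and $\kappa:\mathcal{L}^{-1}(0)\hookrightarrow\mathbb{C}^8$ the inclusion. Let $J:M\to\mathbb{R}$, $J([z_1,\dots,z_8])=\frac12|z_1|^2$. Hamiltonian vector fields are defined by $\omega(X^f,\cdot)=df$. Then $J$ is smooth,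 $X^J$ has a unique complete flow $\Phi^J_t$ on $M$, and the following hold. 1. For every $p\in M$ with $dJ(p)\neq 0$, one has $\Phi^J_{2\pi}(p)=p$ and $\inf\{t>0\mid \Phi^J_t(p)=p\}=2\pi$; that is, the period of $p$ is exactly $2\pi$. 2. The flow is $\Phi^J_t([z_1,z_2,\dots,z_8])=[e^{-it}z_1,z_2,\dots,z_8]$. In particular, on the set $U_1\subset M$ where $z_3,\dots,z_8$ are all nonzero, in the coordinates $(z_1,z_2)$ obtained by choosing the representative with $z_3,\dots,z_8>0$, it is $(z_1,z_2)\mapsto(e^{-it}z_1,z_2)$. 3. The flow descends to an action of $S^1=\mathbb{R}/2\pi\mathbb{Z}$ on $M$, which preserves the set $\{p\in M\mid dJ(p)\neq 0\}$ and acts freely on it. -/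

import Mathlib

open scoped Manifold ContDiff Topology

namespace Octagon

noncomputable section

/-! ### The level set of the momentum map on `ℂ⁸`

Coordinates are indexed by `Fin 8`, so that the usual `z₁, …, z₈` are `z 0, …, z 7`; index
arithmetic is modulo `8`. -/

/-- The coefficients of the six manifold equations. -/
def coeff : Matrix (Fin 6) (Fin 8) ℤ :=
  !![1, 0, 0, 0,  1,  0,  0, 0;
     0, 1, 0, 0,  1,  0,  1, 0;
     0, 0, 1, 0,  0,  0,  1, 0;
     0, 0, 0, 1, -1,  0,  1, 0;
     0, 0, 0, 0,  1, -1,  1, 0;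
     0, 0, 0, 0,  1,  0, -1, 1]

/-- The constants of the six manifold equations. -/
def level : Fin 6 → ℤ := ![6, 10, 6, 4, 2, 4]

/-- The momentum map `ℂ⁸ → ℝ⁶`. -/
def momentMap (z : Fin 8 → ℂ) (i : Fin 6) : ℝ :=
  -1 / 2 * (∑ j, (coeff i j : ℝ) * ‖z j‖ ^ 2 - level i)

/-- The zero level of the momentum map. -/
abbrev LevelSet : Type := {z : Fin 8 → ℂ // momentMap z = 0}

/-- The torus `𝕋⁶`. -/
abbrev Torus : Type := Fin 6 → Circle

/-- The character of `𝕋⁶` by which it acts on the `j`-th coordinate of `ℂ⁸`. -/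
def character (j : Fin 8) : Torus →* Circle where
  toFun θ := ∏ i, θ i ^ coeff i j
  map_one' := by simp
  map_mul' θ η := by simp [mul_zpow, Finset.prod_mul_distrib]

/-- The action of `𝕋⁶` on `ℂ⁸` generated by the momentum map: the `i`-th circle acts through the
Hamiltonian flow of `momentMap · i`, which multiplies `z j` by `exp (coeff i j * t * I)`. -/
def torusAct (θ : Torus) (z : Fin 8 → ℂ) : Fin 8 → ℂ := fun j => (character j θ : ℂ) * z j

lemma norm_torusAct (θ : Torus) (z : Fin 8 → ℂ) (j : Fin 8) : ‖torusAct θ z j‖ = ‖z j‖ := by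
  simp [torusAct, Circle.norm_coe]

lemma momentMap_torusAct (θ : Torus) (z : Fin 8 → ℂ) :
    momentMap (torusAct θ z) = momentMap z := by
  funext i
  simp only [momentMap, norm_torusAct]

instance : MulAction Torus LevelSet where
  smul θ z := ⟨torusAct θ z.1, by rw [momentMap_torusAct, z.2]⟩
  one_smul z := Subtype.ext (by funext j; change (character j 1 : ℂ) * z.1 j = z.1 j; simp)
  mul_smul θ η z := Subtype.ext (by
    funext j
    change (character j (θ * η) : ℂ) * z.1 j = (character j θ : ℂ) * ((character j η : ℂ) * z.1 j)
    simp [mul_assoc])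

lemma smul_apply (θ : Torus) (z : LevelSet) (j : Fin 8) :
    (θ • z).1 j = (character j θ : ℂ) * z.1 j := rfl

/-- The symplectic quotient `M = 𝓛⁻¹(0) / 𝕋⁶`, with the quotient topology. -/
def M : Type := MulAction.orbitRel.Quotient Torus LevelSet

instance : TopologicalSpace M := instTopologicalSpaceQuotient

/-- The quotient map `τ : 𝓛⁻¹(0) → M`. -/
def proj (z : LevelSet) : M := Quotient.mk _ z

lemma proj_eq_iff {z w : LevelSet} : proj z = proj w ↔ ∃ θ : Torus, θ • w = z :=
  Quotient.eq (r := MulAction.orbitRel Torus LevelSet)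

lemma proj_surjective : Function.Surjective proj := Quotient.mk_surjective

lemma isQuotientMap_proj : Topology.IsQuotientMap proj := isQuotientMap_quotient_mk'

lemma norm_eq_of_proj_eq {z w : LevelSet} (h : proj z = proj w) (j : Fin 8) :
    ‖z.1 j‖ = ‖w.1 j‖ := by
  obtain ⟨θ, rfl⟩ := proj_eq_iff.1 h
  exact norm_torusAct θ w.1 j

/-- The function `|z_j|²` on `M`. -/
def normSq (j : Fin 8) : M → ℝ :=
  Quotient.lift (fun z : LevelSet => ‖z.1 j‖ ^ 2) fun z w h => by
    rw [norm_eq_of_proj_eq (Quotient.sound h : proj z = proj w)]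

@[simp] lemma normSq_proj (j : Fin 8) (z : LevelSet) : normSq j (proj z) = ‖z.1 j‖ ^ 2 := rfl

/-- The function `J = |z₁|² / 2`. -/
def J (p : M) : ℝ := normSq 0 p / 2

/-! ### The charts of `M`

On `𝓛⁻¹(0)` every `|z_k|²` is an affine function of `(|z₁|², |z₃|²)`, with linear part `normal k`
and constant part `offset k` (these are the sides of the octagon). -/

/-- The inward normals of the sides of the octagon. -/
def normal : Fin 8 → ℤ × ℤ :=
  ![(1, 0), (1, 1), (0, 1), (-1, 1), (-1, 0), (-1, -1), (0, -1), (1, -1)]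

/-- The constants of the sides of the octagon. -/
def offset : Fin 8 → ℤ := ![0, -2, 0, 4, 6, 10, 6, 4]

/-- The coefficient of `normal ν` in the expansion of `normal k` in the basis
`normal ν, normal (ν + 1)` of `ℤ²`. -/
def expFst (ν k : Fin 8) : ℤ :=
  (normal k).1 * (normal (ν + 1)).2 - (normal k).2 * (normal (ν + 1)).1

/-- The coefficient of `normal (ν + 1)` in the expansion of `normal k` in the basis
`normal ν, normal (ν + 1)` of `ℤ²`. -/
def expSnd (ν k : Fin 8) : ℤ :=
  (normal ν).1 * (normal k).2 - (normal ν).2 * (normal k).1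

/-- The manifold equations solved for `|z_k|²` in terms of `w = (z_ν, z_{ν+1})`. -/
def solvedSq (ν : Fin 8) (w : ℂ × ℂ) (k : Fin 8) : ℝ :=
  expFst ν k * (‖w.1‖ ^ 2 - offset ν) + expSnd ν k * (‖w.2‖ ^ 2 - offset (ν + 1)) + offset k

/-- The domain of the parametrisation `φ_ν`: all expressions under the roots are positive. -/
def chartDomain (ν : Fin 8) : Set (ℂ × ℂ) :=
  {w | ∀ k, k ≠ ν → k ≠ ν + 1 → 0 < solvedSq ν w k}

/-- The representative in `ℂ⁸` of `φ_ν(w)`: the `ν`-th and the `(ν+1)`-st coordinates are given by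
`w`, the other six are positive real numbers. -/
def param (ν : Fin 8) (w : ℂ × ℂ) : Fin 8 → ℂ := fun k =>
  if k = ν then w.1 else if k = ν + 1 then w.2 else ((Real.sqrt (solvedSq ν w k) : ℝ) : ℂ)

/-- The set `U_ν` of points of `M` where only `z_ν` and `z_{ν+1}` may vanish. -/
def chartSet (ν : Fin 8) : Set M := {p | ∀ k, k ≠ ν → k ≠ ν + 1 → normSq k p ≠ 0}

/-- The inverse of `φ_ν` upstairs: rotate `z` by the element of `𝕋⁶` that makes all coordinates
but the `ν`-th and the `(ν+1)`-st positive, and read off these two. -/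
def coord (ν : Fin 8) (z : Fin 8 → ℂ) : ℂ × ℂ :=
  (z ν * ∏ k ∈ Finset.univ.erase ν, (z k / (‖z k‖ : ℂ)) ^ expFst ν k,
   z (ν + 1) * ∏ k ∈ Finset.univ.erase (ν + 1), (z k / (‖z k‖ : ℂ)) ^ expSnd ν k)


lemma normal_expand (ν k : Fin 8) :
    (normal k).1 = expFst ν k * (normal ν).1 + expSnd ν k * (normal (ν + 1)).1 ∧
    (normal k).2 = expFst ν k * (normal ν).2 + expSnd ν k * (normal (ν + 1)).2 := by
  revert ν k; decide

lemma expFst_self (ν : Fin 8) : expFst ν ν = 1 := by revert ν; decide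
lemma expFst_succ (ν : Fin 8) : expFst ν (ν + 1) = 0 := by revert ν; decide
lemma expSnd_self (ν : Fin 8) : expSnd ν ν = 0 := by revert ν; decide
lemma expSnd_succ (ν : Fin 8) : expSnd ν (ν + 1) = 1 := by revert ν; decide
lemma succ_ne (ν : Fin 8) : ν + 1 ≠ ν := by revert ν; decide

lemma coeff_expFst (ν : Fin 8) (i : Fin 6) : ∑ k, coeff i k * expFst ν k = 0 := by
  revert ν i; decide
lemma coeff_expSnd (ν : Fin 8) (i : Fin 6) : ∑ k, coeff i k * expSnd ν k = 0 := by
  revert ν i; decide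
lemma coeff_offset (i : Fin 6) : ∑ k, coeff i k * offset k = level i := by
  revert i; decide

lemma momentMap_eq_zero_iff (z : Fin 8 → ℂ) :
    momentMap z = 0 ↔ ∀ i, ∑ j, (coeff i j : ℝ) * ‖z j‖ ^ 2 = level i := by
  rw [funext_iff]
  refine forall_congr' fun i => ?_
  simp only [momentMap, Pi.zero_apply]
  constructor <;> intro h <;> linarith

lemma sq_eq (z : LevelSet) (k : Fin 8) :
    ‖z.1 k‖ ^ 2 = (normal k).1 * ‖z.1 0‖ ^ 2 + (normal k).2 * ‖z.1 2‖ ^ 2 + offset k := by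
  have h := (momentMap_eq_zero_iff z.1).1 z.2
  have h0 := h 0
  have h1 := h 1
  have h2 := h 2
  have h3 := h 3
  have h4 := h 4
  have h5 := h 5
  simp [Fin.sum_univ_eight, coeff, level] at h0 h1 h2 h3 h4 h5
  fin_cases k <;> simp [normal, offset] <;> linarith

lemma solvedSq_eq (ν : Fin 8) (z : LevelSet) (w : ℂ × ℂ) (h1 : ‖w.1‖ = ‖z.1 ν‖)
    (h2 : ‖w.2‖ = ‖z.1 (ν + 1)‖) (k : Fin 8) : solvedSq ν w k = ‖z.1 k‖ ^ 2 := by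
  have e1 : ((normal k).1 : ℝ) = expFst ν k * (normal ν).1 + expSnd ν k * (normal (ν + 1)).1 := by
    exact_mod_cast (normal_expand ν k).1
  have e2 : ((normal k).2 : ℝ) = expFst ν k * (normal ν).2 + expSnd ν k * (normal (ν + 1)).2 := by
    exact_mod_cast (normal_expand ν k).2
  rw [solvedSq, h1, h2, sq_eq z ν, sq_eq z (ν + 1), sq_eq z k, e1, e2]
  ring

lemma solvedSq_self (ν : Fin 8) (w : ℂ × ℂ) : solvedSq ν w ν = ‖w.1‖ ^ 2 := by
  simp [solvedSq, expFst_self, expSnd_self]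

lemma solvedSq_succ (ν : Fin 8) (w : ℂ × ℂ) : solvedSq ν w (ν + 1) = ‖w.2‖ ^ 2 := by
  simp [solvedSq, expFst_succ, expSnd_succ]

lemma param_self (ν : Fin 8) (w : ℂ × ℂ) : param ν w ν = w.1 := by simp [param]

lemma param_succ (ν : Fin 8) (w : ℂ × ℂ) : param ν w (ν + 1) = w.2 := by
  simp [param]

lemma param_of_ne {ν k : Fin 8} (w : ℂ × ℂ) (h : k ≠ ν) (h' : k ≠ ν + 1) :
    param ν w k = ((Real.sqrt (solvedSq ν w k) : ℝ) : ℂ) := by simp [param, h, h']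

lemma norm_param {ν : Fin 8} {w : ℂ × ℂ} (hw : w ∈ chartDomain ν) (k : Fin 8) :
    ‖param ν w k‖ ^ 2 = solvedSq ν w k := by
  by_cases h : k = ν
  · subst h; rw [param_self, solvedSq_self]
  by_cases h' : k = ν + 1
  · subst h'; rw [param_succ, solvedSq_succ]
  rw [param_of_ne w h h', Complex.norm_real, Real.norm_eq_abs, sq_abs,
    Real.sq_sqrt (hw k h h').le]

lemma param_mem {ν : Fin 8} {w : ℂ × ℂ} (hw : w ∈ chartDomain ν) :
    momentMap (param ν w) = 0 := by
  rw [momentMap_eq_zero_iff]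
  intro i
  have e1 : ∑ k, (coeff i k : ℝ) * expFst ν k = 0 := by exact_mod_cast coeff_expFst ν i
  have e2 : ∑ k, (coeff i k : ℝ) * expSnd ν k = 0 := by exact_mod_cast coeff_expSnd ν i
  have e3 : ∑ k, (coeff i k : ℝ) * offset k = level i := by exact_mod_cast coeff_offset i
  calc ∑ k, (coeff i k : ℝ) * ‖param ν w k‖ ^ 2
      = (∑ k, (coeff i k : ℝ) * expFst ν k) * (‖w.1‖ ^ 2 - offset ν)
        + (∑ k, (coeff i k : ℝ) * expSnd ν k) * (‖w.2‖ ^ 2 - offset (ν + 1))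
        + ∑ k, (coeff i k : ℝ) * offset k := by
        rw [Finset.sum_mul, Finset.sum_mul, ← Finset.sum_add_distrib, ← Finset.sum_add_distrib]
        refine Finset.sum_congr rfl fun k _ => ?_
        rw [norm_param hw, solvedSq]; ring
    _ = level i := by rw [e1, e2, e3]; ring

lemma prod_zpow_sum {ι : Type*} [Fintype ι] (c : Circle) (f : ι → ℤ) :
    ∏ i, c ^ f i = c ^ ∑ i, f i := by
  classical
  induction (Finset.univ : Finset ι) using Finset.induction_on with
  | empty => simp
  | insert a s ha ih => rw [Finset.prod_insert ha, Finset.sum_insert ha, ih, zpow_add]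

lemma coe_prod_circle {ι : Type*} (s : Finset ι) (f : ι → Circle) :
    ((∏ i ∈ s, f i : Circle) : ℂ) = ∏ i ∈ s, (f i : ℂ) :=
  map_prod Circle.coeHom f s

lemma prod_character (θ : Torus) (e : Fin 8 → ℤ) (he : ∀ i, ∑ k, coeff i k * e k = 0) :
    ∏ k, character k θ ^ e k = 1 := by
  have : ∀ k, character k θ ^ e k = ∏ i, θ i ^ (coeff i k * e k) := fun k => by
    simp [character, zpow_mul, Finset.prod_zpow]
  simp only [this]
  rw [Finset.prod_comm]
  refine Finset.prod_eq_one fun i _ => ?_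
  rw [prod_zpow_sum, he, zpow_zero]

lemma twist_invariant (θ : Torus) (z : Fin 8 → ℂ) (e : Fin 8 → ℤ) (j : Fin 8) (hj : e j = 1)
    (he : ∀ i, ∑ k, coeff i k * e k = 0) :
    torusAct θ z j * ∏ k ∈ Finset.univ.erase j,
        (torusAct θ z k / (‖torusAct θ z k‖ : ℂ)) ^ e k =
      z j * ∏ k ∈ Finset.univ.erase j, (z k / (‖z k‖ : ℂ)) ^ e k := by
  have h := prod_character θ e he
  rw [← Finset.mul_prod_erase _ _ (Finset.mem_univ j), hj, zpow_one] at h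
  have h' : (character j θ : ℂ) *
      ∏ k ∈ Finset.univ.erase j, (character k θ : ℂ) ^ e k = 1 := by
    have := congrArg (fun c : Circle => (c : ℂ)) h
    simp only [Circle.coe_one] at this
    rw [← this, Circle.coe_mul, coe_prod_circle]
    simp only [Circle.coe_zpow]
  simp only [norm_torusAct]
  simp only [torusAct, mul_div_assoc, mul_zpow, Finset.prod_mul_distrib]
  linear_combination (z j * ∏ k ∈ Finset.univ.erase j, (z k / (‖z k‖ : ℂ)) ^ e k) * h'

lemma coord_torusAct (ν : Fin 8) (θ : Torus) (z : Fin 8 → ℂ) :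
    coord ν (torusAct θ z) = coord ν z :=
  Prod.ext (twist_invariant θ z _ ν (expFst_self ν) (coeff_expFst ν))
    (twist_invariant θ z _ (ν + 1) (expSnd_succ ν) (coeff_expSnd ν))

lemma coord_param {ν : Fin 8} {w : ℂ × ℂ} (hw : w ∈ chartDomain ν) :
    coord ν (param ν w) = w := by
  have key : ∀ k, k ≠ ν → k ≠ ν + 1 → param ν w k / (‖param ν w k‖ : ℂ) = 1 := by
    intro k h h'
    have hp := Real.sqrt_pos.2 (hw k h h')
    rw [param_of_ne w h h', Complex.norm_real, Real.norm_of_nonneg hp.le]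
    exact div_self (by exact_mod_cast hp.ne')
  refine Prod.ext ?_ ?_
  · change param ν w ν * _ = w.1
    rw [param_self, Finset.prod_eq_one, mul_one]
    intro k hk
    by_cases h' : k = ν + 1
    · rw [h', expFst_succ, zpow_zero]
    · rw [key k (Finset.ne_of_mem_erase hk) h', one_zpow]
  · change param ν w (ν + 1) * _ = w.2
    rw [param_succ, Finset.prod_eq_one, mul_one]
    intro k hk
    by_cases h' : k = ν
    · rw [h', expSnd_self, zpow_zero]
    · rw [key k h' (Finset.ne_of_mem_erase hk), one_zpow]

lemma norm_twist (z : Fin 8 → ℂ) (e : Fin 8 → ℤ) (j : Fin 8)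
    (h : ∀ k, k ≠ j → e k = 0 ∨ z k ≠ 0) :
    ‖z j * ∏ k ∈ Finset.univ.erase j, (z k / (‖z k‖ : ℂ)) ^ e k‖ = ‖z j‖ := by
  rw [norm_mul, norm_prod, Finset.prod_eq_one, mul_one]
  intro k hk
  rcases h k (Finset.ne_of_mem_erase hk) with h0 | h0
  · simp [h0]
  · rw [norm_zpow, norm_div, Complex.norm_real, norm_norm, div_self (norm_ne_zero_iff.2 h0),
      one_zpow]

lemma norm_coord {ν : Fin 8} {z : Fin 8 → ℂ} (hz : ∀ k, k ≠ ν → k ≠ ν + 1 → z k ≠ 0) :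
    ‖(coord ν z).1‖ = ‖z ν‖ ∧ ‖(coord ν z).2‖ = ‖z (ν + 1)‖ := by
  constructor
  · refine norm_twist z _ ν fun k hk => ?_
    by_cases h' : k = ν + 1
    · exact Or.inl (by rw [h', expFst_succ])
    · exact Or.inr (hz k hk h')
  · refine norm_twist z _ (ν + 1) fun k hk => ?_
    by_cases h' : k = ν
    · exact Or.inl (by rw [h', expSnd_self])
    · exact Or.inr (hz k h' hk)

lemma solvedSq_coord {ν : Fin 8} {z : LevelSet} (hz : ∀ k, k ≠ ν → k ≠ ν + 1 → z.1 k ≠ 0)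
    (k : Fin 8) : solvedSq ν (coord ν z.1) k = ‖z.1 k‖ ^ 2 :=
  solvedSq_eq ν z _ (norm_coord hz).1 (norm_coord hz).2 k

lemma coord_mem {ν : Fin 8} {z : LevelSet} (hz : ∀ k, k ≠ ν → k ≠ ν + 1 → z.1 k ≠ 0) :
    coord ν z.1 ∈ chartDomain ν := fun k h h' => by
  rw [solvedSq_coord hz]
  exact pow_pos (norm_pos_iff.2 (hz k h h')) 2

/-- Integer coefficients of the relation `normal k = expFst ν k • normal ν + …` in terms of the
rows of `coeff`. -/
def relCoeff (ν k : Fin 8) (i : Fin 6) : ℤ :=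
  (![1, 1, 1, 1, -1, 1] : Fin 6 → ℤ) i *
    (let j : Fin 8 := (![0, 1, 2, 3, 5, 7] : Fin 6 → Fin 8) i
    (if j = k then 1 else 0) - (if j = ν then expFst ν k else 0) -
      (if j = ν + 1 then expSnd ν k else 0))

set_option maxRecDepth 20000 in
lemma relCoeff_spec (ν k j : Fin 8) : ∑ i, relCoeff ν k i * coeff i j =
    (if j = k then 1 else 0) - (if j = ν then expFst ν k else 0) -
      (if j = ν + 1 then expSnd ν k else 0) := by
  revert ν k j; decide

/-- The phase of a complex number. -/
def phase (z : ℂ) : Circle := Circle.exp z.arg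

lemma norm_mul_phase (z : ℂ) : (‖z‖ : ℂ) * phase z = z := by
  simp [phase, Circle.coe_exp, Complex.norm_mul_exp_arg_mul_I]

lemma phase_eq {z : ℂ} (hz : z ≠ 0) : (phase z : ℂ) = z / (‖z‖ : ℂ) := by
  have : (‖z‖ : ℂ) ≠ 0 := by exact_mod_cast norm_ne_zero_iff.2 hz
  rw [eq_div_iff this, mul_comm, norm_mul_phase]

/-- The element of the torus that normalises `z`. -/
def normaliser (ν : Fin 8) (z : Fin 8 → ℂ) : Torus := fun i =>
  ∏ k, phase (z k) ^ (-relCoeff ν k i)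

lemma character_normaliser (ν : Fin 8) (z : Fin 8 → ℂ) (j : Fin 8) :
    character j (normaliser ν z) = ∏ k, phase (z k) ^ (-((if j = k then 1 else 0) -
      (if j = ν then expFst ν k else 0) - (if j = ν + 1 then expSnd ν k else 0))) := by
  simp only [character, normaliser, MonoidHom.coe_mk, OneHom.coe_mk, ← Finset.prod_zpow,
    ← zpow_mul]
  rw [Finset.prod_comm]
  refine Finset.prod_congr rfl fun k _ => ?_
  rw [prod_zpow_sum, ← relCoeff_spec, ← Finset.sum_neg_distrib]
  congr 1
  exact Finset.sum_congr rfl fun i _ => by ring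

lemma param_coord {ν : Fin 8} {z : LevelSet} (hz : ∀ k, k ≠ ν → k ≠ ν + 1 → z.1 k ≠ 0) :
    torusAct (normaliser ν z.1) z.1 = param ν (coord ν z.1) := by
  have aux : ∀ (e : Fin 8 → ℤ) (j : Fin 8), e j = 1 → (∀ k, k ≠ j → e k = 0 ∨ z.1 k ≠ 0) →
      ((∏ k, phase (z.1 k) ^ (-((if j = k then 1 else 0) - e k)) : Circle) : ℂ) =
      ∏ k ∈ Finset.univ.erase j, (z.1 k / (‖z.1 k‖ : ℂ)) ^ e k := by
    intro e j hj h
    rw [← Finset.mul_prod_erase _ _ (Finset.mem_univ j), if_pos rfl, hj, sub_self, neg_zero,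
      zpow_zero, one_mul, coe_prod_circle]
    refine Finset.prod_congr rfl fun k hk => ?_
    have hne := Finset.ne_of_mem_erase hk
    rw [Circle.coe_zpow, if_neg hne.symm, zero_sub, neg_neg]
    rcases h k hne with h0 | h0
    · simp [h0]
    · rw [phase_eq h0]
  funext j
  by_cases h : j = ν
  · subst h
    rw [param_self, torusAct, character_normaliser, coord, mul_comm, ← aux _ j (expFst_self j)]
    · simp [(succ_ne j).symm]
    · intro k hk
      by_cases h' : k = j + 1
      · exact Or.inl (by rw [h', expFst_succ])
      · exact Or.inr (hz k hk h')
  by_cases h' : j = ν + 1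
  · subst h'
    rw [param_succ, torusAct, character_normaliser, coord, mul_comm,
      ← aux _ (ν + 1) (expSnd_succ ν)]
    · simp [succ_ne ν]
    · intro k hk
      by_cases h' : k = ν
      · exact Or.inl (by rw [h', expSnd_self])
      · exact Or.inr (hz k h' hk)
  · have hp := norm_pos_iff.2 (hz j h h')
    rw [param_of_ne _ h h', solvedSq_coord hz, Real.sqrt_sq hp.le, torusAct, character_normaliser,
      Finset.prod_eq_single j]
    · simp only [h, h', if_true, if_false, sub_zero, zpow_neg, zpow_one, Circle.coe_inv]
      rw [phase_eq (hz j h h'), inv_div, div_mul_cancel₀ _ (hz j h h')]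
    · intro k _ hk
      simp [h, h', hk.symm]
    · simp

lemma exists_chart_aux (z : LevelSet) : ∃ ν : Fin 8, ∀ k, k ≠ ν → k ≠ ν + 1 → z.1 k ≠ 0 := by
  have adj : ∀ j k, z.1 j = 0 → z.1 k = 0 → j = k ∨ k = j + 1 ∨ j = k + 1 := by
    intro j k hj hk
    have h := fun i => sq_eq z i
    have p := fun i => sq_nonneg ‖z.1 i‖
    have hj' := h j
    have hk' := h k
    rw [hj] at hj'
    rw [hk] at hk'
    have q0 := (h 0).symm ▸ p 0
    have q1 := (h 1).symm ▸ p 1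
    have q2 := (h 2).symm ▸ p 2
    have q3 := (h 3).symm ▸ p 3
    have q4 := (h 4).symm ▸ p 4
    have q5 := (h 5).symm ▸ p 5
    have q6 := (h 6).symm ▸ p 6
    have q7 := (h 7).symm ▸ p 7
    clear h p hj hk
    generalize ‖z.1 0‖ ^ 2 = a at *
    generalize ‖z.1 2‖ ^ 2 = b at *
    simp [normal, offset] at q0 q1 q2 q3 q4 q5 q6 q7
    revert hj' hk'
    fin_cases j <;> fin_cases k <;> simp [normal, offset] <;> intros <;> linarith
  by_cases h0 : ∃ j, z.1 j = 0
  · obtain ⟨j, hj⟩ := h0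
    by_cases h1 : z.1 (j + 1) = 0
    · refine ⟨j, fun k hk hk' h => ?_⟩
      rcases adj j k hj h with e | e | e
      · exact hk e.symm
      · exact hk' e
      · have := adj (j + 1) k h1 h
        subst e
        clear hj h1 h
        revert this hk hk'
        clear adj
        revert k; decide
    · refine ⟨j - 1, fun k hk hk' h => ?_⟩
      rw [sub_add_cancel] at hk'
      rcases adj j k hj h with e | e | e
      · exact hk' e.symm
      · exact h1 (e ▸ h)
      · exact hk (by rw [e, add_sub_cancel_right])
  · push Not at h0
    exact ⟨0, fun k _ _ => h0 k⟩

lemma proj_mem_chartSet {ν : Fin 8} {z : LevelSet} :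
    proj z ∈ chartSet ν ↔ ∀ k, k ≠ ν → k ≠ ν + 1 → z.1 k ≠ 0 := by
  simp [chartSet]

lemma proj_param_coord {ν : Fin 8} {z : LevelSet} (hz : proj z ∈ chartSet ν) :
    proj ⟨param ν (coord ν z.1), param_mem (coord_mem (proj_mem_chartSet.1 hz))⟩ = proj z :=
  proj_eq_iff.2 ⟨normaliser ν z.1, Subtype.ext (param_coord (proj_mem_chartSet.1 hz))⟩

lemma proj_param_mem {ν : Fin 8} {w : ℂ × ℂ} (hw : w ∈ chartDomain ν) :
    proj ⟨param ν w, param_mem hw⟩ ∈ chartSet ν := by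
  rw [proj_mem_chartSet]
  intro k h h' h0
  have := norm_param hw k
  change param ν w k = 0 at h0
  rw [h0, norm_zero] at this
  have := hw k h h'
  simp_all

lemma zero_mem_chartDomain : (0 : ℂ × ℂ) ∈ chartDomain 0 := by
  intro k h h'
  fin_cases k <;> simp_all [solvedSq, expFst, expSnd, normal, offset] <;> norm_num

instance : Inhabited M := ⟨proj ⟨param 0 0, param_mem zero_mem_chartDomain⟩⟩

open Classical in
/-- The parametrisation `φ_ν`, on `chartDomain ν` (with a junk value elsewhere). -/
def φ (ν : Fin 8) (w : ℂ × ℂ) : M :=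
  if h : w ∈ chartDomain ν then proj ⟨param ν w, param_mem h⟩ else default

lemma φ_eq {ν : Fin 8} {w : ℂ × ℂ} (h : w ∈ chartDomain ν) :
    φ ν w = proj ⟨param ν w, param_mem h⟩ := dif_pos h

/-- The map `coord ν` on the quotient. -/
def coordM (ν : Fin 8) : M → ℂ × ℂ :=
  Quotient.lift (fun z : LevelSet => coord ν z.1) fun z w h => by
    obtain ⟨θ, rfl⟩ := proj_eq_iff.1 (Quotient.sound h : proj z = proj w)
    exact coord_torusAct ν θ w.1

@[simp] lemma coordM_proj (ν : Fin 8) (z : LevelSet) : coordM ν (proj z) = coord ν z.1 := rfl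

lemma continuous_normSq (j : Fin 8) : Continuous (normSq j) := by
  refine isQuotientMap_proj.continuous_iff.2 ?_
  exact ((continuous_apply j).comp continuous_subtype_val).norm.pow 2

lemma isOpen_chartSet (ν : Fin 8) : IsOpen (chartSet ν) := by
  have : chartSet ν = ⋂ k, ⋂ (_ : k ≠ ν), ⋂ (_ : k ≠ ν + 1), {p | normSq k p ≠ 0} := by
    ext p; simp [chartSet]
  rw [this]
  exact isOpen_iInter_of_finite fun k => isOpen_iInter_of_finite fun _ =>
    isOpen_iInter_of_finite fun _ => isOpen_ne_fun (continuous_normSq k) continuous_const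

lemma contDiff_solvedSq (ν k : Fin 8) : ContDiff ℝ ∞ fun w => solvedSq ν w k := by
  have h1 : ContDiff ℝ ∞ fun w : ℂ × ℂ => ‖w.1‖ ^ 2 := contDiff_fst.norm_sq ℝ
  have h2 : ContDiff ℝ ∞ fun w : ℂ × ℂ => ‖w.2‖ ^ 2 := contDiff_snd.norm_sq ℝ
  unfold solvedSq
  fun_prop

lemma isOpen_chartDomain (ν : Fin 8) : IsOpen (chartDomain ν) := by
  have : chartDomain ν = ⋂ k, ⋂ (_ : k ≠ ν), ⋂ (_ : k ≠ ν + 1), {w | 0 < solvedSq ν w k} := by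
    ext w; simp [chartDomain]
  rw [this]
  exact isOpen_iInter_of_finite fun k => isOpen_iInter_of_finite fun _ =>
    isOpen_iInter_of_finite fun _ =>
      isOpen_lt continuous_const (contDiff_solvedSq ν k).continuous

lemma contDiffOn_param (ν : Fin 8) : ContDiffOn ℝ ∞ (param ν) (chartDomain ν) := by
  rw [contDiffOn_pi]
  intro k
  by_cases h : k = ν
  · subst h; simp only [param_self]; exact contDiff_fst.contDiffOn
  by_cases h' : k = ν + 1
  · subst h'; simp only [param_succ]; exact contDiff_snd.contDiffOn
  simp only [param_of_ne _ h h']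
  exact Complex.ofRealCLM.contDiff.comp_contDiffOn
    ((contDiff_solvedSq ν k).contDiffOn.sqrt fun w hw => (hw k h h').ne')

lemma contDiffAt_twist (e : Fin 8 → ℤ) (j : Fin 8) {z : Fin 8 → ℂ}
    (h : ∀ k, k ≠ j → e k = 0 ∨ z k ≠ 0) :
    ContDiffAt ℝ ∞ (fun z : Fin 8 → ℂ =>
      z j * ∏ k ∈ Finset.univ.erase j, (z k / (‖z k‖ : ℂ)) ^ e k) z := by
  have ev : ∀ k, ContDiffAt ℝ ∞ (fun z : Fin 8 → ℂ => z k) z := fun k =>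
    (contDiff_apply ℝ ℂ k).contDiffAt
  refine (ev j).mul (contDiffAt_prod fun k hk => ?_)
  rcases h k (Finset.ne_of_mem_erase hk) with h0 | h0
  · simp only [h0, zpow_zero]; exact contDiffAt_const
  · have hn : (‖z k‖ : ℂ) ≠ 0 := by exact_mod_cast norm_ne_zero_iff.2 h0
    have hd : ContDiffAt ℝ ∞ (fun z : Fin 8 → ℂ => z k / (‖z k‖ : ℂ)) z := by
      simp only [div_eq_mul_inv]
      exact (ev k).mul ((Complex.ofRealCLM.contDiff.contDiffAt.comp z ((ev k).norm ℝ h0)).inv hn)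
    rcases Int.eq_nat_or_neg (e k) with ⟨n, h | h⟩
    · simp only [h, zpow_natCast]; exact hd.pow n
    · simp only [h, zpow_neg, zpow_natCast]
      exact (hd.pow n).inv (pow_ne_zero _ (div_ne_zero h0 hn))

lemma contDiffAt_coord {ν : Fin 8} {z : Fin 8 → ℂ} (hz : ∀ k, k ≠ ν → k ≠ ν + 1 → z k ≠ 0) :
    ContDiffAt ℝ ∞ (coord ν) z := by
  refine ContDiffAt.prodMk ?_ ?_
  · refine contDiffAt_twist _ ν fun k hk => ?_
    by_cases h' : k = ν + 1
    · exact Or.inl (by rw [h', expFst_succ])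
    · exact Or.inr (hz k hk h')
  · refine contDiffAt_twist _ (ν + 1) fun k hk => ?_
    by_cases h' : k = ν
    · exact Or.inl (by rw [h', expSnd_self])
    · exact Or.inr (hz k h' hk)

lemma continuousOn_coordM (ν : Fin 8) : ContinuousOn (coordM ν) (chartSet ν) := by
  rw [isQuotientMap_proj.continuousOn_isOpen_iff (isOpen_chartSet ν)]
  intro z hz
  exact ((contDiffAt_coord (proj_mem_chartSet.1 hz)).continuousAt.comp
    continuous_subtype_val.continuousAt).continuousWithinAt

lemma continuousOn_φ (ν : Fin 8) : ContinuousOn (φ ν) (chartDomain ν) := by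
  rw [continuousOn_iff_continuous_domRestrict]
  have : (chartDomain ν).domRestrict (φ ν) =
      fun w : chartDomain ν => proj ⟨param ν w, param_mem w.2⟩ := by
    funext w; exact φ_eq w.2
  rw [this]
  exact isQuotientMap_proj.continuous.comp
    ((continuousOn_iff_continuous_domRestrict.1 (contDiffOn_param ν).continuousOn).subtype_mk _)

/-- The chart `φ_ν⁻¹ : U_ν → ℂ²` of `M`. -/
def chart (ν : Fin 8) : OpenPartialHomeomorph M (ℂ × ℂ) where
  toFun := coordM ν
  invFun := φ ν
  source := chartSet ν
  target := chartDomain ν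
  map_source' p hp := by
    obtain ⟨z, rfl⟩ := proj_surjective p
    exact coord_mem (proj_mem_chartSet.1 hp)
  map_target' w hw := by rw [φ_eq hw]; exact proj_param_mem hw
  left_inv' p hp := by
    obtain ⟨z, rfl⟩ := proj_surjective p
    rw [coordM_proj, φ_eq (coord_mem (proj_mem_chartSet.1 hp)), proj_param_coord hp]
  right_inv' w hw := by rw [φ_eq hw, coordM_proj, coord_param hw]
  open_source := isOpen_chartSet ν
  open_target := isOpen_chartDomain ν
  continuousOn_toFun := continuousOn_coordM ν
  continuousOn_invFun := continuousOn_φ ν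

lemma exists_chart (p : M) : ∃ ν, p ∈ chartSet ν := by
  obtain ⟨z, rfl⟩ := proj_surjective p
  obtain ⟨ν, h⟩ := exists_chart_aux z
  exact ⟨ν, proj_mem_chartSet.2 h⟩

/-- The index of a preferred chart at `p`. -/
def index (p : M) : Fin 8 := (exists_chart p).choose

lemma mem_chartSet_index (p : M) : p ∈ chartSet (index p) := (exists_chart p).choose_spec

instance : ContinuousSMul Torus LevelSet where
  continuous_smul := by
    refine Continuous.subtype_mk (continuous_pi fun j => ?_) _
    have h : Continuous fun θ : Torus => (character j θ : ℂ) := by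
      refine continuous_subtype_val.comp ?_
      have hi : ∀ i, Continuous fun θ : Torus => θ i := continuous_apply
      change Continuous fun θ : Torus => ∏ i, θ i ^ coeff i j
      exact continuous_finsetProd _ fun i _ => (continuous_zpow (coeff i j)).comp (hi i)
    exact (h.comp continuous_fst).mul
      ((continuous_apply j).comp (continuous_subtype_val.comp continuous_snd))

instance : T2Space M := by
  have ho : IsOpenQuotientMap proj :=
    ⟨proj_surjective, isQuotientMap_proj.continuous,
      isOpenMap_quotient_mk'_mul (Γ := Torus) (T := LevelSet)⟩
  rw [t2Space_iff_of_isOpenQuotientMap ho]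
  have hc : IsClosed {q : Torus × (LevelSet × LevelSet) | q.1 • q.2.2 = q.2.1} :=
    isClosed_eq (by fun_prop) (by fun_prop)
  convert isClosedMap_snd_of_compactSpace _ hc using 1
  ext ⟨z, w⟩
  simp [proj_eq_iff]

/-- The atlas of `M` formed by the eight charts. -/
instance : ChartedSpace (ℂ × ℂ) M where
  atlas := Set.range chart
  chartAt p := chart (index p)
  mem_chart_source := mem_chartSet_index
  chart_mem_atlas _ := Set.mem_range_self _

instance : IsManifold 𝓘(ℝ, ℂ × ℂ) ∞ M := by
  refine isManifold_of_contDiffOn _ _ _ ?_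
  rintro _ _ ⟨ν, rfl⟩ ⟨μ, rfl⟩
  have : ContDiffOn ℝ ∞ (fun w => coord μ (param ν w))
      (((chart ν).symm ≫ₕ chart μ).source) := by
    intro w hw
    rw [OpenPartialHomeomorph.trans_source] at hw
    have hw1 : w ∈ chartDomain ν := hw.1
    have hw2 : φ ν w ∈ chartSet μ := hw.2
    rw [φ_eq hw1, proj_mem_chartSet] at hw2
    exact ((contDiffAt_coord hw2).comp w ((contDiffOn_param ν).contDiffAt
      ((isOpen_chartDomain ν).mem_nhds hw1))).contDiffWithinAt
  simp only [modelWithCornersSelf_coe, modelWithCornersSelf_coe_symm, Function.id_comp,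
    Function.comp_id, Set.range_id, Set.inter_univ, Set.preimage_id]
  refine this.congr fun w hw => ?_
  rw [OpenPartialHomeomorph.trans_source] at hw
  have hw1 : w ∈ chartDomain ν := hw.1
  change coordM μ (φ ν w) = _
  rw [φ_eq hw1, coordM_proj]

/-! ### The symplectic form and Hamiltonian flows -/

/-- The standard symplectic form `(i/2) ∑ dz_j ∧ dz̄_j = ∑ dx_j ∧ dy_j` on `ℂ⁸`. -/
def stdForm (u v : Fin 8 → ℂ) : ℝ := ∑ j, ((u j).re * (v j).im - (u j).im * (v j).re)

/-- The symplectic form `ω` of the quotient, determined by `τ^* ω = κ^* ω_st`. Since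
`τ ∘ param ν = φ ν`, it is the pullback of the standard form under the local section `param ν`
of `τ`, in the chart that identifies `T_p M` with `ℂ²`. -/
def symplecticForm (p : M) (u v : TangentSpace 𝓘(ℝ, ℂ × ℂ) p) : ℝ :=
  stdForm (fderiv ℝ (param (index p)) (coordM (index p) p) u)
    (fderiv ℝ (param (index p)) (coordM (index p) p) v)

/-- In the charts, `ω` is `dx ∧ dy + du ∧ dv`. -/
lemma symplecticForm_eq (p : M) (a b : ℂ × ℂ) : symplecticForm p a b =
    (a.1.re * b.1.im - a.1.im * b.1.re) + (a.2.re * b.2.im - a.2.im * b.2.re) := by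
  obtain ⟨z, rfl⟩ := proj_surjective p
  have hz := mem_chartSet_index (proj z)
  set ν := index (proj z) with hν
  have hw : coord ν z.1 ∈ chartDomain ν := coord_mem (proj_mem_chartSet.1 hz)
  have hd : HasFDerivAt (param ν) (fderiv ℝ (param ν) (coord ν z.1)) (coord ν z.1) :=
    (((contDiffOn_param ν).contDiffAt ((isOpen_chartDomain ν).mem_nhds hw)).differentiableAt
      (by simp)).hasFDerivAt
  have hk := fun k => (hasFDerivAt_pi'.1 hd) k
  have e1 : ∀ c, fderiv ℝ (param ν) (coord ν z.1) c ν = c.1 := fun c => by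
    have := (hk ν).unique ((hasFDerivAt_fst (𝕜 := ℝ)).congr_of_eventuallyEq
      (Filter.Eventually.of_forall fun w => param_self ν w))
    exact congrArg (fun L : ℂ × ℂ →L[ℝ] ℂ => L c) this
  have e2 : ∀ c, fderiv ℝ (param ν) (coord ν z.1) c (ν + 1) = c.2 := fun c => by
    have := (hk (ν + 1)).unique ((hasFDerivAt_snd (𝕜 := ℝ)).congr_of_eventuallyEq
      (Filter.Eventually.of_forall fun w => param_succ ν w))
    exact congrArg (fun L : ℂ × ℂ →L[ℝ] ℂ => L c) this
  have e3 : ∀ c k, k ≠ ν → k ≠ ν + 1 → (fderiv ℝ (param ν) (coord ν z.1) c k).im = 0 := by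
    intro c k h h'
    have := (Complex.imCLM.hasFDerivAt.comp _ (hk k)).unique
      ((hasFDerivAt_const (0 : ℝ) (coord ν z.1)).congr_of_eventuallyEq
      (Filter.Eventually.of_forall fun w => by
        simp [param_of_ne w h h']))
    exact congrArg (fun L : ℂ × ℂ →L[ℝ] ℝ => L c) this
  change stdForm (fderiv ℝ (param ν) (coord ν z.1) a) (fderiv ℝ (param ν) (coord ν z.1) b) = _
  rw [stdForm, Finset.sum_eq_add ν (ν + 1) (succ_ne ν).symm]
  · simp only [e1, e2]
  · intro k _ h
    simp [e3 _ k h.1 h.2]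
  · simp
  · simp

/-- The angular velocity of `z` along the tangent vector `u`. -/
def angular (z u : ℂ) : ℝ := (z.re * u.im - z.im * u.re) / ‖z‖ ^ 2

lemma hasDerivAt_unit {ζ : ℝ → ℂ} {u : ℂ} (h : HasDerivAt ζ u 0) (h0 : ζ 0 ≠ 0) :
    HasDerivAt (fun t => ζ t / (‖ζ t‖ : ℂ))
      (ζ 0 / (‖ζ 0‖ : ℂ) * (Complex.I * angular (ζ 0) u)) 0 := by
  have hn : ‖ζ 0‖ ≠ 0 := norm_ne_zero_iff.2 h0
  have hn' : (‖ζ 0‖ : ℂ) ≠ 0 := by exact_mod_cast hn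
  have hs : HasDerivAt (fun t => ‖ζ t‖) ((2 * inner ℝ (ζ 0) u) / (2 * ‖ζ 0‖)) 0 := by
    have := (h.norm_sq).sqrt (pow_ne_zero 2 hn)
    simpa [Real.sqrt_sq (norm_nonneg _)] using this
  have hq := h.div hs.ofReal_comp hn'
  refine hq.congr_deriv ?_
  have hsq : ((‖ζ 0‖ : ℝ) : ℂ) ^ 2 = ζ 0 * (starRingEnd ℂ) (ζ 0) := by
    rw [Complex.mul_conj, Complex.normSq_eq_norm_sq]; push_cast; ring
  have hi : inner ℝ (ζ 0) u = (ζ 0).re * u.re + (ζ 0).im * u.im := by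
    simp [Complex.inner]; ring
  have hre : ((inner ℝ (ζ 0) u : ℝ) : ℂ) + Complex.I * ((ζ 0).re * u.im - (ζ 0).im * u.re : ℝ) =
      (starRingEnd ℂ) (ζ 0) * u := by
    rw [hi]
    refine Complex.ext ?_ ?_
    · simp
    · simp; ring
  rw [angular]
  push_cast at hre ⊢
  field_simp
  rw [hsq]
  linear_combination (-ζ 0) * hre

lemma hasDerivAt_twist {ζ : ℝ → Fin 8 → ℂ} {u : Fin 8 → ℂ} (hζ : HasDerivAt ζ u 0)
    (e : Fin 8 → ℤ) (j : Fin 8) (h : ∀ k, k ≠ j → e k = 0 ∨ ζ 0 k ≠ 0) :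
    HasDerivAt (fun t => ζ t j * ∏ k ∈ Finset.univ.erase j, (ζ t k / (‖ζ t k‖ : ℂ)) ^ e k)
      ((∏ k ∈ Finset.univ.erase j, (ζ 0 k / (‖ζ 0 k‖ : ℂ)) ^ e k) *
        (u j + Complex.I * ζ 0 j *
          ((∑ k ∈ Finset.univ.erase j, e k * angular (ζ 0 k) (u k) : ℝ) : ℂ))) 0 := by
  have hk := hasDerivAt_pi.1 hζ
  have key : ∀ k, k ≠ j → HasDerivAt (fun t => (ζ t k / (‖ζ t k‖ : ℂ)) ^ e k)
      ((ζ 0 k / (‖ζ 0 k‖ : ℂ)) ^ e k * (Complex.I * ((e k * angular (ζ 0 k) (u k) : ℝ) : ℂ)))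
      0 := by
    intro k hkj
    rcases h k hkj with h0 | h0
    · simp only [h0, zpow_zero]
      simpa using hasDerivAt_const (0 : ℝ) (1 : ℂ)
    · have hn' : ζ 0 k / (‖ζ 0 k‖ : ℂ) ≠ 0 :=
        div_ne_zero h0 (by exact_mod_cast norm_ne_zero_iff.2 h0)
      refine ((hasDerivAt_zpow (e k) _ (Or.inl hn')).scomp (0 : ℝ)
        (hasDerivAt_unit (hk k) h0)).congr_deriv ?_
      rw [zpow_sub_one₀ hn', smul_eq_mul]
      push_cast
      generalize ζ 0 k / (‖ζ 0 k‖ : ℂ) = x at hn' ⊢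
      field_simp
  have prod : ∀ s : Finset (Fin 8), j ∉ s →
      HasDerivAt (fun t => ∏ k ∈ s, (ζ t k / (‖ζ t k‖ : ℂ)) ^ e k)
        ((∏ k ∈ s, (ζ 0 k / (‖ζ 0 k‖ : ℂ)) ^ e k) *
          (Complex.I * ((∑ k ∈ s, e k * angular (ζ 0 k) (u k) : ℝ) : ℂ))) 0 := by
    intro s
    induction s using Finset.induction_on with
    | empty => intro _; simpa using hasDerivAt_const (0 : ℝ) (1 : ℂ)
    | insert a s ha ih =>
      intro hj
      rw [Finset.mem_insert, not_or] at hj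
      simp only [Finset.prod_insert ha, Finset.sum_insert ha]
      refine ((key a (Ne.symm hj.1)).mul (ih hj.2)).congr_deriv ?_
      push_cast
      ring
  refine ((hk j).mul (prod _ (Finset.notMem_erase j _))).congr_deriv ?_
  ring

/-- The defining property `τ^* ω = κ^* ω_st` of the symplectic form of the quotient: for tangent
vectors `u`, `v` of the level set at the same point, `ω (dτ u, dτ v) = ω_st (u, v)`. -/
theorem symplecticForm_proj (γ δ : ℝ → LevelSet) (h0 : δ 0 = γ 0) (u v : Fin 8 → ℂ)
    (hu : HasDerivAt (fun t => (γ t).1) u 0) (hv : HasDerivAt (fun t => (δ t).1) v 0) :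
    symplecticForm (proj (γ 0))
      (mfderiv 𝓘(ℝ, ℝ) 𝓘(ℝ, ℂ × ℂ) (fun t => proj (γ t)) 0 (1 : ℝ))
      (mfderiv 𝓘(ℝ, ℝ) 𝓘(ℝ, ℂ × ℂ) (fun t => proj (δ t)) 0 (1 : ℝ)) = stdForm u v := by
  have hz := proj_mem_chartSet.1 (mem_chartSet_index (proj (γ 0)))
  have hvel : ∀ (η : ℝ → LevelSet) (w : Fin 8 → ℂ), η 0 = γ 0 →
      HasDerivAt (fun t => (η t).1) w 0 → ∀ a,
      HasDerivAt (fun t => coord (index (proj (γ 0))) (η t).1) a 0 →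
      (mfderiv 𝓘(ℝ, ℝ) 𝓘(ℝ, ℂ × ℂ) (fun t => proj (η t)) 0 (1 : ℝ) : ℂ × ℂ) = a := by
    intro η w hη hw a ha
    have hc : ContinuousAt (fun t => proj (η t)) 0 :=
      isQuotientMap_proj.continuous.continuousAt.comp
        (Topology.IsInducing.subtypeVal.continuousAt_iff.2 hw.continuousAt)
    have : HasMFDerivAt 𝓘(ℝ, ℝ) 𝓘(ℝ, ℂ × ℂ) (fun t => proj (η t)) 0
        (ContinuousLinearMap.toSpanSingleton ℝ a) := by
      refine ⟨hc, ?_⟩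
      have hd : HasFDerivWithinAt (fun t => coord (index (proj (η 0))) (η t).1)
          (ContinuousLinearMap.toSpanSingleton ℝ a) (Set.range (id : ℝ → ℝ)) 0 := by
        rw [hη]; exact ha.hasFDerivAt.hasFDerivWithinAt
      exact hd
    rw [this.mfderiv]
    exact one_smul ℝ a
  set ν := index (proj (γ 0)) with hν
  have c1 : ∀ z : LevelSet, (∀ k, k ≠ ν → k ≠ ν + 1 → z.1 k ≠ 0) →
      ∀ k, k ≠ ν → expFst ν k = 0 ∨ z.1 k ≠ 0 := by
    intro z hz k hk
    by_cases h' : k = ν + 1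
    · exact Or.inl (by rw [h', expFst_succ])
    · exact Or.inr (hz k hk h')
  have c2 : ∀ z : LevelSet, (∀ k, k ≠ ν → k ≠ ν + 1 → z.1 k ≠ 0) →
      ∀ k, k ≠ ν + 1 → expSnd ν k = 0 ∨ z.1 k ≠ 0 := by
    intro z hz k hk
    by_cases h' : k = ν
    · exact Or.inl (by rw [h', expSnd_self])
    · exact Or.inr (hz k h' hk)
  have hz' : ∀ k, k ≠ ν → k ≠ ν + 1 → (δ 0).1 k ≠ 0 := by rw [h0]; exact hz
  have d1 := (hasDerivAt_twist hu _ ν (c1 _ hz)).prodMk (hasDerivAt_twist hu _ (ν + 1) (c2 _ hz))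
  have d2 := (hasDerivAt_twist hv _ ν (c1 _ hz')).prodMk
    (hasDerivAt_twist hv _ (ν + 1) (c2 _ hz'))
  rw [h0] at d2
  have rad : ∀ (η : ℝ → LevelSet) (w : Fin 8 → ℂ), η 0 = γ 0 →
      HasDerivAt (fun t => (η t).1) w 0 → ∀ k,
      (inner ℝ ((γ 0).1 k) (w k) : ℝ) = expFst ν k * inner ℝ ((γ 0).1 ν) (w ν) +
        expSnd ν k * inner ℝ ((γ 0).1 (ν + 1)) (w (ν + 1)) := by
    intro η w hη hw k
    have hk := hasDerivAt_pi.1 hw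
    have l := (hk k).norm_sq
    have r := (((((hk ν).norm_sq.sub_const (offset ν : ℝ)).const_mul (expFst ν k : ℝ)).add
      (((hk (ν + 1)).norm_sq.sub_const (offset (ν + 1) : ℝ)).const_mul
        (expSnd ν k : ℝ))).add_const (offset k : ℝ))
    have := l.unique (r.congr_of_eventuallyEq (Filter.Eventually.of_forall fun t =>
      (solvedSq_eq ν (η t) ((η t).1 ν, (η t).1 (ν + 1)) rfl rfl k).symm))
    rw [hη] at this
    linarith
  have ru := rad γ u rfl hu
  have rv := rad δ v h0 hv
  refine (congrArg₂ (fun a b : ℂ × ℂ => symplecticForm (proj (γ 0)) a b)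
    (hvel γ u rfl hu _ d1) (hvel δ v h0 hv _ d2)).trans ((symplecticForm_eq _ _ _).trans ?_)
  clear d1 d2 rad hvel hu hv h0 hz'
  have unit : ∀ (e : Fin 8 → ℤ) (j : Fin 8), (∀ k, k ≠ j → e k = 0 ∨ (γ 0).1 k ≠ 0) →
      ‖∏ k ∈ Finset.univ.erase j, ((γ 0).1 k / (‖(γ 0).1 k‖ : ℂ)) ^ e k‖ = 1 := by
    intro e j h
    rw [norm_prod, Finset.prod_eq_one]
    intro k hk
    rcases h k (Finset.ne_of_mem_erase hk) with h0 | h0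
    · simp [h0]
    · rw [norm_zpow, norm_div, Complex.norm_real, norm_norm, div_self (norm_ne_zero_iff.2 h0),
        one_zpow]
  have rot : ∀ (P a b z : ℂ) (B C : ℝ), ‖P‖ = 1 →
      (P * (a + Complex.I * z * B)).re * (P * (b + Complex.I * z * C)).im -
        (P * (a + Complex.I * z * B)).im * (P * (b + Complex.I * z * C)).re =
      (a.re * b.im - a.im * b.re) + C * inner ℝ z a - B * inner ℝ z b := by
    intro P a b z B C hP
    have hP' : P.re * P.re + P.im * P.im = 1 := by
      rw [← Complex.normSq_apply, Complex.normSq_eq_norm_sq, hP, one_pow]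
    simp only [Complex.inner, Complex.mul_re, Complex.mul_im, Complex.add_re, Complex.add_im,
      Complex.I_re, Complex.I_im, Complex.ofReal_re, Complex.ofReal_im, Complex.conj_re,
      Complex.conj_im]
    linear_combination ((a.re * b.im - a.im * b.re) + C * (z.re * a.re + z.im * a.im)
      - B * (z.re * b.re + z.im * b.im)) * hP'
  rw [rot _ _ _ _ _ _ (unit _ _ (c1 _ hz)), rot _ _ _ _ _ _ (unit _ _ (c2 _ hz))]
  have ang : ∀ k, k ≠ ν → k ≠ ν + 1 → (u k).re * (v k).im - (u k).im * (v k).re =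
      angular ((γ 0).1 k) (v k) * inner ℝ ((γ 0).1 k) (u k) -
        angular ((γ 0).1 k) (u k) * inner ℝ ((γ 0).1 k) (v k) := by
    intro k h h'
    have hn : ‖(γ 0).1 k‖ ^ 2 ≠ 0 := pow_ne_zero 2 (norm_ne_zero_iff.2 (hz k h h'))
    have hs : ‖(γ 0).1 k‖ ^ 2 = ((γ 0).1 k).re ^ 2 + ((γ 0).1 k).im ^ 2 := by
      rw [← Complex.normSq_eq_norm_sq, Complex.normSq_apply]; ring
    rw [hs] at hn
    simp only [angular, Complex.inner, Complex.mul_re, Complex.conj_re, Complex.conj_im, hs]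
    generalize ((γ 0).1 k).re = x at *
    generalize ((γ 0).1 k).im = y at *
    field_simp
    ring
  have split : ∀ f : Fin 8 → ℝ,
      ∑ k, f k = f ν + f (ν + 1) + ∑ k ∈ (Finset.univ.erase ν).erase (ν + 1), f k := by
    intro f
    rw [← Finset.add_sum_erase _ f (Finset.mem_univ ν),
      ← Finset.add_sum_erase (Finset.univ.erase ν) f
        (Finset.mem_erase.2 ⟨succ_ne ν, Finset.mem_univ (ν + 1)⟩), add_assoc]
  have s1 : ∀ w : Fin 8 → ℂ,
      ∑ k ∈ Finset.univ.erase ν, (expFst ν k : ℝ) * angular ((γ 0).1 k) (w k) =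
      ∑ k ∈ (Finset.univ.erase ν).erase (ν + 1),
        (expFst ν k : ℝ) * angular ((γ 0).1 k) (w k) := by
    intro w
    rw [← Finset.add_sum_erase (Finset.univ.erase ν) _
      (Finset.mem_erase.2 ⟨succ_ne ν, Finset.mem_univ (ν + 1)⟩), expFst_succ]
    simp
  have s2 : ∀ w : Fin 8 → ℂ,
      ∑ k ∈ Finset.univ.erase (ν + 1), (expSnd ν k : ℝ) * angular ((γ 0).1 k) (w k) =
      ∑ k ∈ (Finset.univ.erase ν).erase (ν + 1),
        (expSnd ν k : ℝ) * angular ((γ 0).1 k) (w k) := by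
    intro w
    rw [Finset.erase_right_comm, ← Finset.add_sum_erase (Finset.univ.erase (ν + 1)) _
      (Finset.mem_erase.2 ⟨(succ_ne ν).symm, Finset.mem_univ ν⟩), expSnd_self]
    simp
  rw [stdForm, split, s1, s1, s2, s2]
  have : ∑ k ∈ (Finset.univ.erase ν).erase (ν + 1),
      ((u k).re * (v k).im - (u k).im * (v k).re) =
      ∑ k ∈ (Finset.univ.erase ν).erase (ν + 1),
      (expFst ν k * angular ((γ 0).1 k) (v k) * inner ℝ ((γ 0).1 ν) (u ν)
      + expSnd ν k * angular ((γ 0).1 k) (v k) * inner ℝ ((γ 0).1 (ν + 1)) (u (ν + 1))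
      - expFst ν k * angular ((γ 0).1 k) (u k) * inner ℝ ((γ 0).1 ν) (v ν)
      - expSnd ν k * angular ((γ 0).1 k) (u k) * inner ℝ ((γ 0).1 (ν + 1)) (v (ν + 1))) := by
    refine Finset.sum_congr rfl fun k hk => ?_
    simp only [Finset.mem_erase, Finset.mem_univ, and_true] at hk
    rw [ang k hk.2 hk.1, ru k, rv k]
    ring
  rw [this]
  simp only [Finset.sum_sub_distrib, Finset.sum_add_distrib, ← Finset.sum_mul]
  ring

/-- `X` is the Hamiltonian vector field of `f`: `ω (X, ·) = df`. -/
def IsHamiltonianVectorField (f : M → ℝ) (X : (p : M) → TangentSpace 𝓘(ℝ, ℂ × ℂ) p) : Prop :=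
  ∀ (p : M) (v : TangentSpace 𝓘(ℝ, ℂ × ℂ) p),
    symplecticForm p (X p) v = mfderiv 𝓘(ℝ, ℂ × ℂ) 𝓘(ℝ, ℝ) f p v

/-- `Φ` is the (complete) flow of the Hamiltonian equation `z' = X^f (z)`. -/
def IsHamiltonianFlow (f : M → ℝ) (Φ : ℝ → M → M) : Prop :=
  ∃ X : (p : M) → TangentSpace 𝓘(ℝ, ℂ × ℂ) p, IsHamiltonianVectorField f X ∧
    ∀ p, Φ 0 p = p ∧ IsMIntegralCurve (I := 𝓘(ℝ, ℂ × ℂ)) (fun t => Φ t p) X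

/-- The period `inf {t > 0 | Φ_t p = p}` of `p` under the flow `Φ`. -/
def period (Φ : ℝ → M → M) (p : M) : ℝ := sInf {t : ℝ | 0 < t ∧ Φ t p = p}

/-- `dJ (p) ≠ 0`. -/
def IsRegular (p : M) : Prop := mfderiv 𝓘(ℝ, ℂ × ℂ) 𝓘(ℝ, ℝ) J p ≠ 0

end

end Octagon

/-! On `ℂ⁸` the Hamiltonian flow of `|z₁|² / 2` multiplies `z₁` by `e^{-it}`. This rotation
preserves every `|z_k|` and commutes with the torus, so it descends to a circle action on `M`. The
heart of the proof is that `t ↦ Circle.exp (-t) • p` is the one and only flow of `J`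
(`isHamiltonianFlow_iff`); all the clauses are then statements about this action.

The verification takes place in the charts, where everything is linear. Let `m = expFst ν 0` and `n
= expSnd ν 0` be the coefficients of `normal 0` in the basis `normal ν, normal (ν + 1)`. In the
chart of index `ν` the circle acts by `(c ^ m * w₁, c ^ n * w₂)` (`coordM_smul`), `J` is `(m|w₁|² +
n|w₂|²) / 2` up to a constant, and `ω` is the standard form (`symplecticForm_eq`). The Hamiltonian
field is therefore `(-i m w₁, -i n w₂)`, which is exactly the velocity of the circle orbits. It is
the only such field because `ω` is nondegenerate, and its flow is unique because the field is smooth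
and `M` is Hausdorff without boundary.

For freeness, `dJ(p) ≠ 0` says that `m w₁` or `n w₂` is nonzero at `p` (`isRegular_iff`). The
weights lie in `{0, 1, -1}`, so `c • p = p` forces `c ^ (±1) = 1`. A weight of larger absolute value
could produce points of shorter period. -/

namespace Octagon

noncomputable section

/-! ### The rotation of the first coordinate -/

/-- The rotation of the first coordinate of `ℂ⁸` by an element of the circle. -/
def rotate (c : Circle) (z : Fin 8 → ℂ) : Fin 8 → ℂ := fun k => if k = 0 then c * z k else z k

lemma norm_rotate (c : Circle) (z : Fin 8 → ℂ) (k : Fin 8) : ‖rotate c z k‖ = ‖z k‖ := by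
  unfold rotate
  split_ifs <;> simp [Circle.norm_coe]

lemma momentMap_rotate (c : Circle) (z : Fin 8 → ℂ) : momentMap (rotate c z) = momentMap z := by
  funext i
  simp only [momentMap, norm_rotate]

lemma rotate_torusAct (c : Circle) (θ : Torus) (z : Fin 8 → ℂ) :
    rotate c (torusAct θ z) = torusAct θ (rotate c z) := by
  funext k
  simp only [rotate, torusAct]
  split_ifs <;> ring

/-- The rotation of the first coordinate, on the level set. -/
def rotateLevel (c : Circle) (z : LevelSet) : LevelSet :=
  ⟨rotate c z.1, by rw [momentMap_rotate, z.2]⟩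

/-- The circle action on `M` that rotates the first homogeneous coordinate. -/
instance : MulAction Circle M where
  smul c := Quotient.lift (fun z => proj (rotateLevel c z)) fun z w h => by
    obtain ⟨θ, rfl⟩ := proj_eq_iff.1 (Quotient.sound h : proj z = proj w)
    exact proj_eq_iff.2 ⟨θ, Subtype.ext (rotate_torusAct c θ w.1).symm⟩
  one_smul p := by
    obtain ⟨z, rfl⟩ := proj_surjective p
    refine congrArg proj (Subtype.ext (funext fun k => ?_))
    simp [rotateLevel, rotate]
  mul_smul c d p := by
    obtain ⟨z, rfl⟩ := proj_surjective p
    refine congrArg proj (Subtype.ext (funext fun k => ?_))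
    simp only [rotateLevel, rotate]
    split_ifs <;> simp [mul_assoc]

lemma smul_proj (c : Circle) (z : LevelSet) : c • proj z = proj (rotateLevel c z) := rfl

@[simp] lemma normSq_smul (c : Circle) (k : Fin 8) (p : M) : normSq k (c • p) = normSq k p := by
  obtain ⟨z, rfl⟩ := proj_surjective p
  rw [smul_proj, normSq_proj, normSq_proj]
  exact congrArg (· ^ 2) (norm_rotate c z.1 k)

/-! ### The circle action in the charts: diagonal with integer weights -/

lemma smul_mem_chartSet {c : Circle} {ν : Fin 8} {p : M} : c • p ∈ chartSet ν ↔ p ∈ chartSet ν := by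
  simp [chartSet]

/-- The factor `c ^ e 0` arises in one of two ways: from `z j` itself when `j = 0`, where `e 0 = 1`,
and otherwise from the phase of `z 0`, which occurs with exponent `e 0`. No coordinate has to be
nonzero, so the resulting formula for `coordM` holds on all of `M`, not only on the chart domain. -/
lemma twist_rotate (c : Circle) (z : Fin 8 → ℂ) (e : Fin 8 → ℤ) (j : Fin 8) (hj : e j = 1) :
    rotate c z j * ∏ k ∈ Finset.univ.erase j, (rotate c z k / (‖rotate c z k‖ : ℂ)) ^ e k =
      (c : ℂ) ^ e 0 * (z j * ∏ k ∈ Finset.univ.erase j, (z k / (‖z k‖ : ℂ)) ^ e k) := by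
  simp only [norm_rotate]
  by_cases h : j = 0
  · subst h
    rw [hj, zpow_one, ← mul_assoc]
    exact congrArg₂ (· * ·) rfl (Finset.prod_congr rfl fun k hk => by
      rw [rotate, if_neg (Finset.ne_of_mem_erase hk)])
  · have h0 : (0 : Fin 8) ∈ Finset.univ.erase j := Finset.mem_erase.2 ⟨Ne.symm h, Finset.mem_univ 0⟩
    rw [← Finset.mul_prod_erase _ _ h0, ← Finset.mul_prod_erase _ _ h0]
    have : ∀ k ∈ (Finset.univ.erase j).erase 0,
        (rotate c z k / (‖z k‖ : ℂ)) ^ e k = (z k / (‖z k‖ : ℂ)) ^ e k := fun k hk => by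
      rw [rotate, if_neg (Finset.ne_of_mem_erase hk)]
    rw [Finset.prod_congr rfl this]
    simp only [rotate, if_neg h, if_true, mul_div_assoc, mul_zpow]
    ring

/-- The rotation of the first homogeneous coordinate, seen in the chart of index `ν`. -/
def rotateChart (ν : Fin 8) (c : Circle) (w : ℂ × ℂ) : ℂ × ℂ :=
  ((c : ℂ) ^ expFst ν 0 * w.1, (c : ℂ) ^ expSnd ν 0 * w.2)

lemma coordM_smul (ν : Fin 8) (c : Circle) (p : M) :
    coordM ν (c • p) = rotateChart ν c (coordM ν p) := by
  obtain ⟨z, rfl⟩ := proj_surjective p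
  exact Prod.ext (twist_rotate c z.1 _ ν (expFst_self ν))
    (twist_rotate c z.1 _ (ν + 1) (expSnd_succ ν))

lemma rotateChart_mem {ν : Fin 8} {w : ℂ × ℂ} (hw : w ∈ chartDomain ν) (c : Circle) :
    rotateChart ν c w ∈ chartDomain ν := by
  intro k h h'
  have := hw k h h'
  simpa [solvedSq, rotateChart, norm_zpow, Circle.norm_coe] using this

lemma φ_rotateChart {ν : Fin 8} {w : ℂ × ℂ} (hw : w ∈ chartDomain ν) (c : Circle) :
    φ ν (rotateChart ν c w) = c • φ ν w := by
  have h1 : coordM ν (φ ν w) = w := (chart ν).right_inv hw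
  have h2 : φ ν w ∈ chartSet ν := (chart ν).map_target hw
  have := (chart ν).left_inv (smul_mem_chartSet.2 h2 : c • φ ν w ∈ chartSet ν)
  change φ ν (coordM ν (c • φ ν w)) = _ at this
  rwa [coordM_smul, h1] at this

/-- Since `normal 0 = (1, 0)`, the weight is the second entry of `normal (ν + 1)`, and all normals
of the octagon have entries in `{0, 1, -1}`. Freeness rests on this. -/
lemma expFst_zero (ν : Fin 8) : expFst ν 0 = 0 ∨ expFst ν 0 = 1 ∨ expFst ν 0 = -1 := by
  revert ν; decide

lemma expSnd_zero (ν : Fin 8) : expSnd ν 0 = 0 ∨ expSnd ν 0 = 1 ∨ expSnd ν 0 = -1 := by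
  revert ν; decide

/-! ### The Hamiltonian field of `J`: integral curves and smoothness -/

/-- The Hamiltonian field of `J` in the chart of index `ν`. -/
def chartField (ν : Fin 8) (w : ℂ × ℂ) : ℂ × ℂ :=
  (-Complex.I * expFst ν 0 * w.1, -Complex.I * expSnd ν 0 * w.2)

lemma contDiff_chartField (ν : Fin 8) : ContDiff ℝ ∞ (chartField ν) :=
  (contDiff_const.mul contDiff_fst).prodMk (contDiff_const.mul contDiff_snd)

/-- The Hamiltonian vector field of `J`. -/
def fieldJ (p : M) : TangentSpace 𝓘(ℝ, ℂ × ℂ) p := chartField (index p) (coordM (index p) p)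

lemma hasDerivAt_zpow_exp (n : ℤ) (a : ℂ) (t : ℝ) :
    HasDerivAt (fun s : ℝ => (Circle.exp (-s) : ℂ) ^ n * a)
      (-Complex.I * n * ((Circle.exp (-t) : ℂ) ^ n * a)) t := by
  have h : ∀ s : ℝ, (Circle.exp (-s) : ℂ) ^ n = Complex.exp (-Complex.I * n * s) := fun s => by
    rw [Circle.coe_exp, ← Complex.exp_int_mul]
    congr 1
    push_cast
    ring
  simp only [h]
  have h1 : HasDerivAt (fun s : ℝ => -Complex.I * n * (s : ℂ)) (-Complex.I * n) t := by
    simpa using (Complex.ofRealCLM.hasDerivAt (x := t)).const_mul (-Complex.I * n)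
  exact (h1.cexp.mul_const a).congr_deriv (by ring)

lemma hasDerivAt_rotateChart (ν : Fin 8) (w : ℂ × ℂ) (t : ℝ) :
    HasDerivAt (fun s : ℝ => rotateChart ν (Circle.exp (-s)) w)
      (chartField ν (rotateChart ν (Circle.exp (-t)) w)) t :=
  (hasDerivAt_zpow_exp _ w.1 t).prodMk (hasDerivAt_zpow_exp _ w.2 t)

lemma continuous_flow (p : M) : Continuous fun t : ℝ => Circle.exp (-t) • p := by
  obtain ⟨z, rfl⟩ := proj_surjective p
  refine isQuotientMap_proj.continuous.comp (Continuous.subtype_mk (continuous_pi fun k => ?_) _)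
  unfold rotate
  split_ifs
  · fun_prop
  · fun_prop

/-- The curves of the circle action are the integral curves of the Hamiltonian field of `J`. -/
lemma isMIntegralCurve_flow (p : M) :
    IsMIntegralCurve (I := 𝓘(ℝ, ℂ × ℂ)) (fun t : ℝ => Circle.exp (-t) • p) fieldJ := by
  intro t
  refine ⟨(continuous_flow p).continuousAt, ?_⟩
  -- The manifold derivative at time `t` is taken in the preferred chart of the point reached. The
  -- orbit has its explicit form there for all times, even if `p` is outside that chart, because
  -- `coordM_smul` is global.
  have h := hasDerivAt_rotateChart (index (Circle.exp (-t) • p))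
    (coordM (index (Circle.exp (-t) • p)) p) t
  simp only [← coordM_smul] at h
  exact h.hasFDerivAt.hasFDerivWithinAt

/-- `fieldJ q` is written in the preferred chart of `q`, which may jump with `q`; smoothness near
`p` requires its expression in one fixed chart. The transition map carries the circle orbit of `q`
in one chart to the same orbit in the other, so its derivative carries velocity to velocity. This
avoids computing the derivative of the transition map. -/
lemma tangentCoordChange_fieldJ (p q : M) (hq : q ∈ chartSet (index p)) :
    tangentCoordChange 𝓘(ℝ, ℂ × ℂ) q p q (fieldJ q) =
      chartField (index p) (coordM (index p) q) := by
  have hs : q ∈ (extChartAt 𝓘(ℝ, ℂ × ℂ) q).source ∩ (extChartAt 𝓘(ℝ, ℂ × ℂ) p).source := by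
    rw [extChartAt_source, extChartAt_source]
    exact ⟨mem_chartSet_index q, hq⟩
  have h := hasFDerivWithinAt_tangentCoordChange hs
  have h1 : HasFDerivAt (coordM (index p) ∘ φ (index q))
      (tangentCoordChange 𝓘(ℝ, ℂ × ℂ) q p q) (coordM (index q) q) := by
    rw [← hasFDerivWithinAt_univ]
    have hr : Set.range 𝓘(ℝ, ℂ × ℂ) = Set.univ := Set.range_id
    rw [hr] at h
    exact h
  have hw : coordM (index q) q ∈ chartDomain (index q) :=
    (chart (index q)).map_source (mem_chartSet_index q)
  have hφ : φ (index q) (coordM (index q) q) = q :=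
    (chart (index q)).left_inv (mem_chartSet_index q)
  have h2 := hasDerivAt_rotateChart (index q) (coordM (index q) q) 0
  have h3 := hasDerivAt_rotateChart (index p) (coordM (index p) q) 0
  have e : ∀ ν w, rotateChart ν (Circle.exp (-0)) w = w := fun ν w => by simp [rotateChart]
  rw [e] at h2 h3
  -- The base point is rewritten as the orbit at time `0`, the form that the chain rule along the
  -- orbit needs.
  rw [← e (index q) (coordM (index q) q)] at h1
  refine (h1.comp_hasDerivAt (0 : ℝ) h2).unique (h3.congr_of_eventuallyEq ?_)
  refine Filter.Eventually.of_forall fun s => ?_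
  simp only [Function.comp_apply]
  rw [φ_rotateChart hw, hφ, coordM_smul]

lemma contMDiffOn_coordM (ν : Fin 8) :
    ContMDiffOn 𝓘(ℝ, ℂ × ℂ) 𝓘(ℝ, ℂ × ℂ) ∞ (coordM ν) (chartSet ν) :=
  contMDiffOn_of_mem_maximalAtlas
    (IsManifold.subset_maximalAtlas (Set.mem_range_self ν : chart ν ∈ atlas (ℂ × ℂ) M))

lemma contMDiff_fieldJ : ContMDiff 𝓘(ℝ, ℂ × ℂ) 𝓘(ℝ, ℂ × ℂ).tangent ∞
    (fun p => (⟨p, fieldJ p⟩ : TangentBundle 𝓘(ℝ, ℂ × ℂ) M)) := by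
  intro p
  refine (Bundle.contMDiffAt_section p).2 ?_
  have hm := (isOpen_chartSet (index p)).mem_nhds (mem_chartSet_index p)
  have h : ContMDiffAt 𝓘(ℝ, ℂ × ℂ) 𝓘(ℝ, ℂ × ℂ) ∞
      (fun q => chartField (index p) (coordM (index p) q)) p :=
    (contDiff_chartField _).contMDiff.contMDiffAt.comp p ((contMDiffOn_coordM _).contMDiffAt hm)
  -- The trivialisation at `p` reads a vector at `q` through `tangentCoordChange`, so near `p` the
  -- section is `chartField` of the fixed chart.
  refine h.congr_of_eventuallyEq (Filter.eventually_of_mem hm fun q hq => ?_)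
  exact tangentCoordChange_fieldJ p q hq

/-! ### The function `J` in the charts -/

lemma normSq_φ {ν : Fin 8} {w : ℂ × ℂ} (hw : w ∈ chartDomain ν) (k : Fin 8) :
    normSq k (φ ν w) = solvedSq ν w k := by
  rw [φ_eq hw, normSq_proj, norm_param hw]

lemma normSq_eq_solvedSq {ν : Fin 8} {p : M} (hp : p ∈ chartSet ν) (k : Fin 8) :
    normSq k p = solvedSq ν (coordM ν p) k := by
  obtain ⟨z, rfl⟩ := proj_surjective p
  exact (solvedSq_coord (proj_mem_chartSet.1 hp) k).symm

lemma contMDiff_J : ContMDiff 𝓘(ℝ, ℂ × ℂ) 𝓘(ℝ, ℝ) ∞ J := by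
  intro p
  have hm := (isOpen_chartSet (index p)).mem_nhds (mem_chartSet_index p)
  have h : ContMDiffAt 𝓘(ℝ, ℂ × ℂ) 𝓘(ℝ, ℝ) ∞
      (fun q => solvedSq (index p) (coordM (index p) q) 0 / 2) p :=
    ((contDiff_solvedSq (index p) 0).div_const 2).contMDiff.contMDiffAt.comp p
      ((contMDiffOn_coordM _).contMDiffAt hm)
  exact h.congr_of_eventuallyEq (Filter.eventually_of_mem hm fun q hq =>
    congrArg (· / 2) (normSq_eq_solvedSq hq 0))

/-- In the chart, `J` is half of `solvedSq ν w 0`, a combination of `|w₁|²` and `|w₂|²` plus a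
constant; the half cancels the `2` from differentiating the squared norms. -/
lemma mfderiv_J (p : M) (v : ℂ × ℂ) : (mfderiv 𝓘(ℝ, ℂ × ℂ) 𝓘(ℝ, ℝ) J p v : ℝ) =
    (expFst (index p) 0 : ℝ) * inner ℝ (coordM (index p) p).1 v.1 +
      (expSnd (index p) 0 : ℝ) * inner ℝ (coordM (index p) p).2 v.2 := by
  set ν := index p with hν
  set w := coordM ν p with hw
  have hwd : w ∈ chartDomain ν := (chart ν).map_source (mem_chartSet_index p)
  have h1 := (hasFDerivAt_fst (𝕜 := ℝ) (p := w)).norm_sq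
  have h2 := (hasFDerivAt_snd (𝕜 := ℝ) (p := w)).norm_sq
  have h := (((((h1.sub_const (offset ν : ℝ)).const_mul (expFst ν 0 : ℝ)).add
    ((h2.sub_const (offset (ν + 1) : ℝ)).const_mul (expSnd ν 0 : ℝ))).add_const
      (offset 0 : ℝ)).const_mul (1 / 2 : ℝ))
  have h' := h.congr_of_eventuallyEq (f₁ := fun w => J (φ ν w))
    (Filter.eventually_of_mem ((isOpen_chartDomain ν).mem_nhds hwd) fun w hw => by
      change normSq 0 (φ ν w) / 2 = _
      rw [normSq_φ hw, solvedSq]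
      exact (one_div_mul_eq_div _ _).symm)
  have hJ : HasMFDerivAt 𝓘(ℝ, ℂ × ℂ) 𝓘(ℝ, ℝ) J p
      ((1 / 2 : ℝ) • ((expFst ν 0 : ℝ) • 2 • (innerSL ℝ w.1).comp (ContinuousLinearMap.fst ℝ ℂ ℂ) +
        (expSnd ν 0 : ℝ) • 2 • (innerSL ℝ w.2).comp (ContinuousLinearMap.snd ℝ ℂ ℂ))) :=
    ⟨contMDiff_J.continuous.continuousAt, h'.hasFDerivWithinAt⟩
  rw [hJ.mfderiv]
  change (1 / 2 : ℝ) * ((expFst ν 0 : ℝ) * (2 • inner ℝ w.1 v.1) +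
    (expSnd ν 0 : ℝ) * (2 • inner ℝ w.2 v.2)) = _
  rw [two_nsmul, two_nsmul]
  ring

/-! ### Uniqueness of the Hamiltonian field and of its flow -/

lemma isHamiltonianVectorField_iff {X : (p : M) → TangentSpace 𝓘(ℝ, ℂ × ℂ) p} :
    IsHamiltonianVectorField J X ↔ X = fieldJ := by
  have key : ∀ p (v : ℂ × ℂ), symplecticForm p (fieldJ p) v =
      mfderiv 𝓘(ℝ, ℂ × ℂ) 𝓘(ℝ, ℝ) J p v := fun p v => by
    rw [mfderiv_J]
    refine (symplecticForm_eq p (chartField _ _) v).trans ?_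
    simp [chartField, Complex.inner]
    ring
  constructor
  · intro h
    funext p
    have hp : ∀ v : ℂ × ℂ, symplecticForm p (X p) v = symplecticForm p (fieldJ p) v := fun v =>
      (h p v).trans (key p v).symm
    generalize fieldJ p = b at hp
    generalize X p = a at hp
    change ℂ × ℂ at a b
    have hp' : ∀ v : ℂ × ℂ,
        (a.1.re * v.1.im - a.1.im * v.1.re) + (a.2.re * v.2.im - a.2.im * v.2.re) =
        (b.1.re * v.1.im - b.1.im * v.1.re) + (b.2.re * v.2.im - b.2.im * v.2.re) := fun v =>
      (symplecticForm_eq p a v).symm.trans ((hp v).trans (symplecticForm_eq p b v))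
    -- Nondegeneracy of `ω`: pairing with the real basis of `ℂ²` recovers the four real components.
    have q1 := hp' (1, 0)
    have q2 := hp' (Complex.I, 0)
    have q3 := hp' (0, 1)
    have q4 := hp' (0, Complex.I)
    simp at q1 q2 q3 q4
    exact Prod.ext (Complex.ext q2 q1) (Complex.ext q4 q3)
  · rintro rfl
    exact key

/-- Two integral curves of a `C¹` field that agree at time `0` agree for all times; the circle
orbits are one such family. -/
lemma isHamiltonianFlow_iff {Φ : ℝ → M → M} :
    IsHamiltonianFlow J Φ ↔ Φ = fun t p => Circle.exp (-t) • p := by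
  constructor
  · rintro ⟨X, hX, h⟩
    rw [isHamiltonianVectorField_iff] at hX
    subst hX
    funext t p
    have : (fun t => Φ t p) = fun t : ℝ => Circle.exp (-t) • p :=
      isMIntegralCurve_Ioo_eq_of_contMDiff_boundaryless (t₀ := 0)
        (contMDiff_fieldJ.of_le (by simp)) (h p).2 (isMIntegralCurve_flow p) (by simp [(h p).1])
    exact congrFun this t
  · rintro rfl
    exact ⟨fieldJ, isHamiltonianVectorField_iff.2 rfl, fun p =>
      ⟨by simp, isMIntegralCurve_flow p⟩⟩

/-! ### Freeness of the action on the regular points of `J` -/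

lemma isRegular_iff (p : M) : IsRegular p ↔
    ¬ ((expFst (index p) 0 : ℂ) * (coordM (index p) p).1 = 0 ∧
      (expSnd (index p) 0 : ℂ) * (coordM (index p) p).2 = 0) := by
  refine not_congr ⟨fun h => ?_, fun h => ?_⟩
  · have h0 : ∀ v : ℂ × ℂ, (expFst (index p) 0 : ℝ) * inner ℝ (coordM (index p) p).1 v.1 +
        (expSnd (index p) 0 : ℝ) * inner ℝ (coordM (index p) p).2 v.2 = 0 := fun v =>
      (mfderiv_J p v).symm.trans (by rw [h]; rfl)
    -- Testing `dJ` on the radial vectors gives `m|w₁|² = 0` and `n|w₂|² = 0`.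
    have h1 := h0 ((coordM (index p) p).1, 0)
    have h2 := h0 (0, (coordM (index p) p).2)
    simpa using And.intro h1 h2
  · refine ContinuousLinearMap.ext fun v => (mfderiv_J p v).trans ?_
    have h1 : (expFst (index p) 0 : ℝ) = 0 ∨ (coordM (index p) p).1 = 0 := by simpa using h.1
    have h2 : (expSnd (index p) 0 : ℝ) = 0 ∨ (coordM (index p) p).2 = 0 := by simpa using h.2
    have e1 : (expFst (index p) 0 : ℝ) * inner ℝ (coordM (index p) p).1 v.1 = 0 := by
      rcases h1 with h1 | h1 <;> simp [h1]
    have e2 : (expSnd (index p) 0 : ℝ) * inner ℝ (coordM (index p) p).2 v.2 = 0 := by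
      rcases h2 with h2 | h2 <;> simp [h2]
    rw [e1, e2, add_zero]
    rfl

/-- The rotation preserves each chart set, so both indices are the same choice from the same
predicate. Regularity at `p` and at `c • p` can thus be compared in one chart. -/
lemma index_smul (c : Circle) (p : M) : index (c • p) = index p := by
  simp only [index, smul_mem_chartSet]

lemma IsRegular.smul {p : M} (hp : IsRegular p) (c : Circle) : IsRegular (c • p) := by
  rw [isRegular_iff] at hp ⊢
  rw [index_smul, coordM_smul]
  simpa [rotateChart, zpow_ne_zero] using hp

lemma eq_one_of_zpow_mul_eq {n : ℤ} (hn : n = 0 ∨ n = 1 ∨ n = -1) {c : Circle} {a : ℂ}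
    (h0 : n * a ≠ 0) (h : (c : ℂ) ^ n * a = a) : c = 1 := by
  have ha : a ≠ 0 := right_ne_zero_of_mul h0
  have hc : (c : ℂ) ^ n = 1 := mul_right_cancel₀ ha (h.trans (one_mul a).symm)
  rcases hn with rfl | rfl | rfl
  · simp at h0
  · exact Circle.ext (by simpa using hc)
  · exact Circle.ext (by simpa using hc)

lemma eq_one_of_smul_eq {p : M} (hp : IsRegular p) {c : Circle} (h : c • p = p) : c = 1 := by
  have hc := coordM_smul (index p) c p
  rw [h] at hc
  by_contra h1
  refine (isRegular_iff p).1 hp ⟨?_, ?_⟩ <;> by_contra h2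
  · exact h1 (eq_one_of_zpow_mul_eq (expFst_zero _) h2 (congrArg Prod.fst hc).symm)
  · exact h1 (eq_one_of_zpow_mul_eq (expSnd_zero _) h2 (congrArg Prod.snd hc).symm)

lemma period_flow {p : M} (hp : IsRegular p) :
    period (fun t p => Circle.exp (-t) • p) p = 2 * Real.pi := by
  refine IsLeast.csInf_eq ⟨⟨Real.two_pi_pos, ?_⟩, fun t ht => ?_⟩
  · simp [Circle.exp_neg]
  · have h := eq_one_of_smul_eq hp ht.2
    rw [Circle.exp_neg, inv_eq_one, Circle.exp_eq_one] at h
    obtain ⟨n, rfl⟩ := h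
    have hn : (0 : ℝ) < n := pos_of_mul_pos_left ht.1 Real.two_pi_pos.le
    have hn' : (1 : ℝ) ≤ n := by exact_mod_cast Int.add_one_le_of_lt (Int.cast_pos.1 hn)
    exact le_mul_of_one_le_left Real.two_pi_pos.le hn'

end

end Octagon

theorem mainTheorem9 :
    -- `J` is smooth and its Hamiltonian vector field has a unique complete flow
    ContMDiff 𝓘(ℝ, ℂ × ℂ) 𝓘(ℝ, ℝ) ∞ Octagon.J ∧
    (∃! Φ : ℝ → Octagon.M → Octagon.M, Octagon.IsHamiltonianFlow Octagon.J Φ) ∧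
    ∀ Φ : ℝ → Octagon.M → Octagon.M, Octagon.IsHamiltonianFlow Octagon.J Φ →
      -- the period of every point with `dJ ≠ 0` is exactly `2π`
      (∀ p, Octagon.IsRegular p → Φ (2 * Real.pi) p = p ∧ Octagon.period Φ p = 2 * Real.pi) ∧
      -- the flow in the coordinates `(z₁, z₂)` on `U₁`
      (∀ (t : ℝ), ∀ w ∈ Octagon.chartDomain 0,
        (Complex.exp (-(Complex.I * t)) * w.1, w.2) ∈ Octagon.chartDomain 0 ∧
        Φ t (Octagon.φ 0 w) = Octagon.φ 0 (Complex.exp (-(Complex.I * t)) * w.1, w.2)) ∧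
      -- the flow in the homogeneous coordinates `[z₁, …, z₈]` on all of `M`
      (∀ (t : ℝ) (z z' : Octagon.LevelSet),
        z'.1 0 = Complex.exp (-(Complex.I * t)) * z.1 0 → (∀ k, k ≠ 0 → z'.1 k = z.1 k) →
        Φ t (Octagon.proj z) = Octagon.proj z') ∧
      -- the flow descends to an action of the circle, free on the (invariant) set `dJ ≠ 0`
      ∃ ρ : Circle →* Equiv.Perm Octagon.M,
        (∀ (t : ℝ) (p : Octagon.M), ρ (Circle.exp t) p = Φ t p) ∧
        ∀ (g : Circle) (p : Octagon.M), Octagon.IsRegular p →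
          Octagon.IsRegular (ρ g p) ∧ (ρ g p = p → g = 1) := by
  refine ⟨Octagon.contMDiff_J, ⟨_, Octagon.isHamiltonianFlow_iff.2 rfl, fun Φ hΦ =>
    Octagon.isHamiltonianFlow_iff.1 hΦ⟩, fun Φ hΦ => ?_⟩
  obtain rfl := Octagon.isHamiltonianFlow_iff.1 hΦ
  have hexp : ∀ t : ℝ, (Circle.exp (-t) : ℂ) = Complex.exp (-(Complex.I * t)) := fun t => by
    rw [Circle.coe_exp]
    congr 1
    push_cast
    ring
  -- As `Φ t` is the action of `Circle.exp (-t)`, the required `ρ g` is the action of `g⁻¹`;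
  -- inversion is a homomorphism since the circle is commutative.
  refine ⟨fun p hp => ⟨by simp [Circle.exp_neg], Octagon.period_flow hp⟩, fun t w hw => ?_,
    fun t z z' h0 h => ?_, (MulAction.toPermHom Circle Octagon.M).comp invMonoidHom,
    fun t p => ?_, fun g p hp => ⟨hp.smul g⁻¹, fun h => ?_⟩⟩
  -- In the chart of index `0` the weights are `(1, 0)`.
  · have e : Octagon.rotateChart 0 (Circle.exp (-t)) w =
        (Complex.exp (-(Complex.I * t)) * w.1, w.2) := by
      have h2 : Octagon.expSnd 0 0 = 0 := by decide
      rw [Octagon.rotateChart, Octagon.expFst_self, h2, hexp, zpow_one, zpow_zero, one_mul]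
    exact e ▸ ⟨Octagon.rotateChart_mem hw _, (Octagon.φ_rotateChart hw _).symm⟩
  · refine congrArg Octagon.proj (Subtype.ext (funext fun k => ?_))
    change Octagon.rotate _ z.1 k = _
    by_cases hk : k = 0
    · subst hk
      rw [Octagon.rotate, if_pos rfl, hexp, h0]
    · rw [Octagon.rotate, if_neg hk, h k hk]
  · change (Circle.exp t)⁻¹ • p = _
    rw [← Circle.exp_neg]
  · exact inv_eq_one.1 (Octagon.eq_one_of_smul_eq hp h)
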